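/- Let $0\le r<N$ and $L\ge 1$ be integers and let $p_1,\dots,p_L\ge 0$, $\sum_i p_i=1$, be class priors. Let $\mathbf\Sigma_1,\dots,\mathbf\Sigma_L\in\mathbb R^{N\times N}$ be random positive semidefinite matrices of rank $r$ whose images $\mathcal R_i=\mathrm{Im}(\mathbf\Sigma_i)$ are independent random subspaces, each having a density with respect to the uniform probability measure on the Grassmann manifold of $r$-dimensional subspaces of $\mathbb R^N$. Let $\mathbf\Phi\in\mathbb R^{M\times N}$ be a random matrix, drawn independently of the $\mathbf\Sigma_i$, whose entries have a joint density and such that $\mathbf\Theta\mathbf\Phi$ has the same law as $\mathbf\Phi$ for every orthogonal $\mathbf\Theta\in\mathbb R^{M\times M}$. Given these matrices, the class $C\in\{1,\dots,L\}$ has law $(p_i)$, the source satisfies $\mathbf x\mid C=i\sim\mathcal N(\mathbf 0,\mathbf\Sigma_i)$, and one observes $\mathbf y=\mathbf\Phi\mathbf x+\mathbf n$ with independent noise $\mathbf n\sim\mathcal N(\mathbf 0,\sigma^2\mathbf I_M)$. Let $P_e=\sum_{i} p_i\,\mathbb P[\hat C\ne i\mid C=i]$ be the misclassification probability, for the given $\mathbf\Sigma_i$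 and $\mathbf\Phi$, of a MAP classifier $\hat C=\arg\max_i p(\mathbf y\mid C=i)\,p_i$, where $p(\mathbf y\mid C=i)$ is the density of $\mathcal N(\mathbf 0,\mathbf\Phi\mathbf\Sigma_i\mathbf\Phi^T+\sigma^2\mathbf I_M)$ and ties are broken in any measurable way. Put $R=2\min\{N-r,r\}$. Suppose that $d_0\in\mathbb R$ satisfies $d_0<R/4$ and that $$M=\lfloor 2d_0+r\rfloor+1 .$$ Then, for almost every realization of $\mathbf\Sigma_1,\dots,\mathbf\Sigma_L$, one has $\dim\mathcal R_i+\dim\mathcal R_j-2\dim(\mathcal R_i\cap\mathcal R_j)=R$ for all $i\ne j$, and, for almost every realization of $\mathbf\Phi$, for every choice of MAP classifiers, the limit below exists in $[-\infty,+\infty]$ and $$\lim_{\sigma^2\to0}\;-\frac{\log P_e}{\log(1/\sigma^2)}>d_0$$ (with the convention $\log 0=-\infty$). In particular $\lfloor 2d_0+r\rfloor+1$ is an upper bound on the minimum number of random measurements that guarantee this decay. -/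

import Mathlib

open MeasureTheory ProbabilityTheory Filter Topology
open scoped ENNReal

noncomputable section

namespace GaussClass

/-! ### The Grassmann manifold: Borel structure and uniform law -/

/-- The Borel structure on the linear subspaces of `ℝᴺ`: a subspace `V` is identified with its
orthogonal projection `P_V`, and the σ-algebra is generated by the maps `V ↦ P_V x`.  On the
subspaces of a fixed dimension `r` this is the Borel σ-algebra of the Grassmann manifold. -/
instance instMeasurableSpaceSubspaces (N : ℕ) :
    MeasurableSpace (Submodule ℝ (EuclideanSpace ℝ (Fin N))) :=
  MeasurableSpace.comap
    (fun V (x : EuclideanSpace ℝ (Fin N)) => V.starProjection x) inferInstance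

theorem measurable_subspace_iff {Ω : Type*} [MeasurableSpace Ω] {N : ℕ}
    {V : Ω → Submodule ℝ (EuclideanSpace ℝ (Fin N))} :
    Measurable V ↔ ∀ x, Measurable fun ω => (V ω).starProjection x := by
  rw [measurable_comap_iff, measurable_pi_iff]
  rfl

theorem norm_sq_starProjection {N : ℕ} (V : Submodule ℝ (EuclideanSpace ℝ (Fin N)))
    (x : EuclideanSpace ℝ (Fin N)) :
    ‖V.starProjection x‖ ^ 2 = ‖x‖ ^ 2 - Metric.infDist x V ^ 2 := by
  have h1 := Submodule.norm_sq_eq_add_norm_sq_starProjection x V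
  have h2 : Metric.infDist x V = ‖Vᗮ.starProjection x‖ := by
    rw [Submodule.starProjection_orthogonal_val, Submodule.starProjection_minimal,
      Metric.infDist_eq_iInf]
    simp [dist_eq_norm]
  rw [h2]; linarith

theorem measurable_span (N r : ℕ) :
    Measurable fun v : Fin r → EuclideanSpace ℝ (Fin N) =>
      Submodule.span ℝ (Set.range v) := by
  rw [measurable_subspace_iff]
  have hd : ∀ x : EuclideanSpace ℝ (Fin N), Measurable fun v : Fin r → EuclideanSpace ℝ (Fin N) =>
      Metric.infDist x (Submodule.span ℝ (Set.range v) : Set (EuclideanSpace ℝ (Fin N))) := by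
    intro x
    refine measurable_of_Iio fun a => IsOpen.measurableSet ?_
    have : (fun v : Fin r → EuclideanSpace ℝ (Fin N) =>
        Metric.infDist x (Submodule.span ℝ (Set.range v) : Set (EuclideanSpace ℝ (Fin N)))) ⁻¹'
          Set.Iio a = ⋃ c : Fin r → ℝ, {v | dist x (∑ i, c i • v i) < a} := by
      ext v
      simp only [Set.mem_preimage, Set.mem_Iio, Set.mem_iUnion, Set.mem_ofPred_eq]
      rw [Metric.infDist_lt_iff ⟨0, Submodule.zero_mem _⟩]
      constructor
      · rintro ⟨y, hy, h⟩
        obtain ⟨c, rfl⟩ := (Submodule.mem_span_range_iff_exists_fun ℝ).1 hy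
        exact ⟨c, h⟩
      · rintro ⟨c, h⟩
        exact ⟨_, (Submodule.mem_span_range_iff_exists_fun ℝ).2 ⟨c, rfl⟩, h⟩
    rw [this]
    refine isOpen_iUnion fun c => isOpen_lt (by fun_prop) continuous_const
  have hn : ∀ x : EuclideanSpace ℝ (Fin N), Measurable fun v : Fin r → EuclideanSpace ℝ (Fin N) =>
      ‖(Submodule.span ℝ (Set.range v)).starProjection x‖ ^ 2 := by
    intro x
    simp_rw [norm_sq_starProjection]
    exact measurable_const.sub ((hd x).pow_const 2)
  intro x
  have : (fun v : Fin r → EuclideanSpace ℝ (Fin N) =>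
      (Submodule.span ℝ (Set.range v)).starProjection x) = fun v => WithLp.toLp 2 fun k =>
      (‖(Submodule.span ℝ (Set.range v)).starProjection (x + EuclideanSpace.single k 1)‖ ^ 2
        - ‖(Submodule.span ℝ (Set.range v)).starProjection (x - EuclideanSpace.single k 1)‖ ^ 2)
        / 4 := by
    funext v
    ext k
    set V := Submodule.span ℝ (Set.range v)
    have key : inner ℝ (V.starProjection x) (V.starProjection (EuclideanSpace.single k 1))
        = (V.starProjection x) k := by
      rw [← Submodule.inner_starProjection_left_eq_right,
        Submodule.starProjection_eq_self_iff.2 (Submodule.starProjection_apply_mem V x)]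
      simp [EuclideanSpace.inner_single_right]
    simp only [map_add, map_sub]
    rw [← key, norm_add_sq_real, norm_sub_sq_real]
    ring
  rw [this]
  exact (WithLp.measurable_toLp 2 _).comp
    (measurable_pi_lambda _ fun k => ((hn _).sub (hn _)).div_const 4)

/-- The uniform (orthogonally invariant) probability law on the Grassmann manifold of
`r`-dimensional subspaces of `ℝᴺ`, `r ≤ N`: the law of the span of `r` independent standard
Gaussian vectors of `ℝᴺ`. -/
def grassmannUniform (N r : ℕ) : Measure (Submodule ℝ (EuclideanSpace ℝ (Fin N))) :=
  (Measure.pi fun _ : Fin r => stdGaussian (EuclideanSpace ℝ (Fin N))).map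
    fun v => Submodule.span ℝ (Set.range v)

instance isProbabilityMeasure_grassmannUniform (N r : ℕ) :
    IsProbabilityMeasure (grassmannUniform N r) :=
  Measure.isProbabilityMeasure_map (measurable_span N r).aemeasurable

/-! ### Source, measurements and classifier -/

/-- `Im S`, as a subspace of `ℝᴺ`. -/
def im {N : ℕ} (S : Matrix (Fin N) (Fin N) ℝ) : Submodule ℝ (EuclideanSpace ℝ (Fin N)) :=
  LinearMap.range (Matrix.toEuclideanLin S)

/-- `dim V + dim W - 2 dim (V ∩ W)`. -/
def dimGap {N : ℕ} (V W : Submodule ℝ (EuclideanSpace ℝ (Fin N))) : ℤ :=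
  (Module.finrank ℝ V : ℤ) + Module.finrank ℝ W - 2 * Module.finrank ℝ (V ⊓ W : Submodule ℝ _)

/-- The product (Borel) σ-algebra on real matrices. -/
instance instMeasurableSpaceMatrix (M N : ℕ) : MeasurableSpace (Matrix (Fin M) (Fin N) ℝ) :=
  inferInstanceAs (MeasurableSpace (Fin M → Fin N → ℝ))

/-- Lebesgue measure on the entries of `M × N` matrices. -/
def matrixVolume (M N : ℕ) : Measure (Matrix (Fin M) (Fin N) ℝ) :=
  Measure.pi fun _ : Fin M => Measure.pi fun _ : Fin N => (volume : Measure ℝ)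

/-- The random matrix `Φ` has a left rotation-invariant distribution: its entries have a joint
density, and `Θ Φ` has the same law as `Φ` for every orthogonal `Θ`. -/
structure LeftRotationInvariant {M N : ℕ} {Ω : Type*} [MeasurableSpace Ω] (Q : Measure Ω)
    (Φ : Ω → Matrix (Fin M) (Fin N) ℝ) : Prop where
  hasPDF : HasPDF Φ Q (matrixVolume M N)
  map_mul_left : ∀ Θ ∈ Matrix.orthogonalGroup (Fin M) ℝ,
    Q.map (fun ω => Θ * Φ ω) = Q.map Φ

/-- The law of `y = Φ x + n`, where `x ∼ 𝒩(0, S)` and `n ∼ 𝒩(0, s I)` are independent. -/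
def measurementLaw {M N : ℕ} (φ : Matrix (Fin M) (Fin N) ℝ) (S : Matrix (Fin N) (Fin N) ℝ)
    (s : ℝ) : Measure (EuclideanSpace ℝ (Fin M)) :=
  ((multivariateGaussian 0 S).prod
      (multivariateGaussian 0 (s • (1 : Matrix (Fin M) (Fin M) ℝ)))).map
    fun z => Matrix.toEuclideanLin φ z.1 + z.2

/-- The density of `𝒩(0, K)` on `ℝᴹ`, for positive definite `K`. -/
def gaussianDensity {M : ℕ} (K : Matrix (Fin M) (Fin M) ℝ) (y : EuclideanSpace ℝ (Fin M)) : ℝ :=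
  (Real.sqrt ((2 * Real.pi) ^ M * K.det))⁻¹ *
    Real.exp (-(y.ofLp ⬝ᵥ K⁻¹.mulVec y.ofLp) / 2)

/-- `p(y | C = i)`: zero-mean Gaussian density with covariance `Φ Σᵢ Φᵀ + s I`. -/
def condDensity {M N : ℕ} (φ : Matrix (Fin M) (Fin N) ℝ) (S : Matrix (Fin N) (Fin N) ℝ)
    (s : ℝ) (y : EuclideanSpace ℝ (Fin M)) : ℝ :=
  gaussianDensity (φ * S * φ.transpose + s • (1 : Matrix (Fin M) (Fin M) ℝ)) y

/-- `c` is a MAP classifier: `c y` maximizes `p(y | C = i) pᵢ` over `i` (ties are broken in any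
measurable way). -/
structure IsMAP {L M N : ℕ} (p : PMF (Fin L)) (S : Fin L → Matrix (Fin N) (Fin N) ℝ)
    (φ : Matrix (Fin M) (Fin N) ℝ) (s : ℝ) (c : EuclideanSpace ℝ (Fin M) → Fin L) : Prop where
  measurable : Measurable c
  le : ∀ y i, condDensity φ (S i) s y * (p i).toReal ≤
    condDensity φ (S (c y)) s y * (p (c y)).toReal

/-- The misclassification probability `∑ᵢ pᵢ ℙ[c(y) ≠ i | C = i]` of the classifier `c`. -/
def errorProb {L M N : ℕ} (p : PMF (Fin L)) (S : Fin L → Matrix (Fin N) (Fin N) ℝ)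
    (φ : Matrix (Fin M) (Fin N) ℝ) (s : ℝ) (c : EuclideanSpace ℝ (Fin M) → Fin L) : ℝ≥0∞ :=
  ∑ i, p i * measurementLaw φ (S i) s {y | c y ≠ i}

end GaussClass

end

/-!
The misclassification probability of a maximizing classifier is squeezed between overlaps
`∫ min (pᵢ fᵢ) (pⱼ fⱼ)` of the class densities: it is at most the sum of all of them and at least
each one. If `d₁`, `d₂` and `d` are the determinants of the two measurement covariances and of
their sum, the overlap is, up to constants depending on the priors, at least `√(min d₁ d₂ / d)`,
because `K₁⁻¹, K₂⁻¹ ≤ K₁⁻¹ + K₂⁻¹`, and at most the Bhattacharyya integral `√(2ᴹ √(d₁ d₂) / d)`.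

A determinant `det (A + s I)` is of order `s ^ (M - rank A)` as `s → 0`. Hence, if `Φ Σᵢ Φᵀ` has
rank `ρ` and `Φ (Σᵢ + Σⱼ) Φᵀ` has rank `τ` for all `i ≠ j`, both bounds are of order
`s ^ ((τ - ρ) / 2)` and the decay exponent is `(τ - ρ) / 2`, or `+∞` if only one class has positive
probability. For subspaces and measurements in generic position `ρ = min (M, r)` and
`τ = min (M, N, 2r)`, since `Im (Σᵢ + Σⱼ) = Im Σᵢ + Im Σⱼ`.
-/

namespace GaussClass

/-! ### Generic position -/

section GenericPosition

theorem isOpen_setOf_le_finrank_span {ι F : Type*} [Finite ι] [NormedAddCommGroup F]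
    [NormedSpace ℝ F] (k : ℕ) :
    IsOpen {x : ι → F | k ≤ Module.finrank ℝ (Submodule.span ℝ (Set.range x))} := by
  have := Fintype.ofFinite ι
  let combination (x : ι → F) : (ι → ℝ) →L[ℝ] F :=
    ∑ i, (ContinuousLinearMap.proj i).smulRight (x i)
  have range_combination (x : ι → F) :
      LinearMap.range (combination x : (ι → ℝ) →ₗ[ℝ] F) = Submodule.span ℝ (Set.range x) := by
    rw [← Fintype.range_linearCombination ℝ x]
    congr 1
    ext
    simp [combination, Fintype.linearCombination_apply]
  have continuous_combination : Continuous combination := by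
    fun_prop
  have h := (isOpen_setOfPred_nat_le_rank (𝕜 := ℝ) (E := ι → ℝ) (F := F) k).preimage
    continuous_combination
  convert h using 1
  ext x
  rw [Set.mem_preimage]
  change k ≤ _ ↔ (k : Cardinal) ≤ LinearMap.rank (combination x : (ι → ℝ) →ₗ[ℝ] F)
  rw [LinearMap.rank, ← Module.finrank_eq_rank, range_combination, Nat.cast_le]

variable {E : Type*} [NormedAddCommGroup E] [NormedSpace ℝ E] [FiniteDimensional ℝ E]
  [MeasurableSpace E] [BorelSpace E]

theorem measurable_finrank_span (ι : Type*) [Finite ι] :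
    Measurable fun x : ι → E => Module.finrank ℝ (Submodule.span ℝ (Set.range x)) :=
  measurable_of_Ici fun k => (isOpen_setOf_le_finrank_span k).measurableSet

theorem measurable_finrank_span_sup_span {Ω ι κ : Type*} [MeasurableSpace Ω] [Finite ι] [Finite κ]
    {x : Ω → ι → E} {y : Ω → κ → E} (hx : Measurable x) (hy : Measurable y) :
    Measurable fun ω => Module.finrank ℝ
      (Submodule.span ℝ (Set.range (x ω)) ⊔ Submodule.span ℝ (Set.range (y ω)) :
        Submodule ℝ E) := by
  have h : Measurable fun ω => Sum.elim (x ω) (y ω) :=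
    measurable_pi_iff.2 (Sum.rec (measurable_pi_iff.1 hx) (measurable_pi_iff.1 hy))
  convert (measurable_finrank_span (ι ⊕ κ)).comp h using 2 with ω
  rw [Function.comp_apply, Set.Sum.elim_range, Submodule.span_union]

theorem ae_finrank_sup_span_eq {μ : Measure E} [SigmaFinite μ]
    (hμ : ∀ V : Submodule ℝ E, V ≠ ⊤ → μ V = 0) (W : Submodule ℝ E) (n : ℕ) :
    ∀ᵐ x ∂Measure.pi fun _ : Fin n => μ,
      Module.finrank ℝ (W ⊔ Submodule.span ℝ (Set.range x) : Submodule ℝ E) =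
        min (Module.finrank ℝ W + n) (Module.finrank ℝ E) := by
  induction n generalizing W with
  | zero =>
    refine Eventually.of_forall fun x => ?_
    rw [Set.range_eq_empty, Submodule.span_empty, sup_bot_eq, add_zero,
      min_eq_left W.finrank_le]
  | succ n ih =>
    obtain rfl | hW := eq_or_ne W ⊤
    · exact Eventually.of_forall fun x => by rw [top_sup_eq, finrank_top, min_eq_right (by omega)]
    let e := MeasurableEquiv.piFinSuccAbove (fun _ : Fin (n + 1) => E) 0
    have he : MeasurePreserving e (Measure.pi fun _ => μ) (μ.prod (Measure.pi fun _ => μ)) :=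
      measurePreserving_piFinSuccAbove (fun _ => μ) 0
    have span_symm (a : E) (x : Fin n → E) :
        W ⊔ Submodule.span ℝ (Set.range (e.symm (a, x))) =
          (W ⊔ Submodule.span ℝ {a}) ⊔ Submodule.span ℝ (Set.range x) := by
      rw [show e.symm (a, x) = (Fin.cons a x : Fin (n + 1) → E) from Fin.insertNth_zero' a x,
        Fin.range_cons, Submodule.span_insert, sup_assoc]
    have hprod : ∀ᵐ z ∂μ.prod (Measure.pi fun _ : Fin n => μ),
        Module.finrank ℝ (W ⊔ Submodule.span ℝ (Set.range (e.symm z)) : Submodule ℝ E) =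
          min (Module.finrank ℝ W + (n + 1)) (Module.finrank ℝ E) := by
      obtain ⟨k, w, hw⟩ :=
        Submodule.fg_iff_exists_fin_generating_family.1 (IsNoetherian.noetherian W)
      have hmeas := measurable_finrank_span_sup_span (measurable_const (a := w))
        e.symm.measurable
      rw [hw] at hmeas
      rw [Measure.ae_prod_iff_ae_ae (measurableSet_eq_fun hmeas measurable_const)]
      filter_upwards [measure_eq_zero_iff_ae_notMem.1 (hμ W hW)] with a ha
      filter_upwards [ih (W ⊔ Submodule.span ℝ {a})] with x hx
      rw [span_symm, hx, Submodule.finrank_sup_span_singleton ha, add_right_comm, add_assoc]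
    filter_upwards [he.quasiMeasurePreserving.ae hprod] with x hx
    rwa [e.symm_apply_apply] at hx

end GenericPosition

/-! ### Ranks -/

section Rank

theorem finrank_map_add_finrank_ker {K V V₂ : Type*} [DivisionRing K] [AddCommGroup V] [Module K V]
    [AddCommGroup V₂] [Module K V₂] [FiniteDimensional K V] (f : V →ₗ[K] V₂) (S : Submodule K V) :
    Module.finrank K (S.map f) + Module.finrank K (LinearMap.ker f) =
      Module.finrank K (LinearMap.ker f ⊔ S : Submodule K V) := by
  rw [← (f.domRestrict (LinearMap.ker f ⊔ S)).finrank_range_add_finrank_ker,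
    LinearMap.range_domRestrict, Submodule.map_sup,
    LinearMap.le_ker_iff_map.1 le_rfl, bot_sup_eq, LinearMap.ker_domRestrict,
    (Submodule.comapSubtypeEquivOfLe le_sup_left).finrank_eq]

variable {M N : ℕ}

theorem rank_mul_add_finrank_ker (φ : Matrix (Fin M) (Fin N) ℝ) (R : Matrix (Fin N) (Fin N) ℝ) :
    (φ * R).rank + Module.finrank ℝ (LinearMap.ker R.vecMulLinear) =
      Module.finrank ℝ
        (LinearMap.ker R.vecMulLinear ⊔ Submodule.span ℝ (Set.range φ.row) :
          Submodule ℝ (Fin N → ℝ)) := by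
  rw [← finrank_map_add_finrank_ker, Submodule.map_span, ← Set.range_comp,
    Matrix.rank_eq_finrank_span_row, show (φ * R).row = R.vecMulLinear ∘ φ.row from rfl]

theorem rank_add_finrank_ker (R : Matrix (Fin N) (Fin N) ℝ) :
    R.rank + Module.finrank ℝ (LinearMap.ker R.vecMulLinear) = N := by
  rw [Matrix.rank_eq_finrank_span_row, ← range_vecMulLinear,
    LinearMap.finrank_range_add_finrank_ker, Module.finrank_fin_fun]

theorem ae_rank_mul_eq (M : ℕ) (R : Matrix (Fin N) (Fin N) ℝ) :
    ∀ᵐ φ ∂matrixVolume M N, (φ * R).rank = min M R.rank := by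
  have hgen : ∀ᵐ φ ∂matrixVolume M N, Module.finrank ℝ
      ↥(LinearMap.ker R.vecMulLinear ⊔ Submodule.span ℝ (Set.range φ.row)) =
      min (Module.finrank ℝ (LinearMap.ker R.vecMulLinear) + M) (Module.finrank ℝ (Fin N → ℝ)) :=
    ae_finrank_sup_span_eq (fun V hV => Measure.addHaar_submodule volume V hV) _ M
  filter_upwards [hgen] with φ hφ
  have h₁ := rank_mul_add_finrank_ker φ R
  have h₂ := rank_add_finrank_ker R
  rw [Module.finrank_fin_fun, ← h₁] at hφ
  omega

open scoped MatrixOrder Matrix.Norms.L2Operator in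
theorem ae_rank_mul_mul_transpose_eq (M : ℕ) {T : Matrix (Fin N) (Fin N) ℝ} (hT : T.PosSemidef) :
    ∀ᵐ φ ∂matrixVolume M N, (φ * T * φ.transpose).rank = min M T.rank := by
  obtain ⟨B, rfl⟩ := CStarAlgebra.nonneg_iff_eq_star_mul_self.mp hT.nonneg
  rw [Matrix.star_eq_conjTranspose, Matrix.conjTranspose_eq_transpose_of_trivial,
    Matrix.rank_transpose_mul_self, ← Matrix.rank_transpose B]
  filter_upwards [ae_rank_mul_eq M B.transpose] with φ hφ
  rw [← hφ, ← Matrix.rank_self_mul_transpose (φ * B.transpose), Matrix.transpose_mul,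
    Matrix.transpose_transpose, Matrix.mul_assoc, Matrix.mul_assoc, Matrix.mul_assoc]

theorem finrank_im (S : Matrix (Fin N) (Fin N) ℝ) : Module.finrank ℝ (im S) = S.rank := by
  rw [im, Matrix.toEuclideanLin_eq_toLin_orthonormal, ← Matrix.rank_eq_finrank_range_toLin]

theorem im_le_im_add {S T : Matrix (Fin N) (Fin N) ℝ} (hS : S.PosSemidef) (hT : T.PosSemidef) :
    im S ≤ im (S + T) := by
  rw [← Submodule.orthogonal_le_orthogonal_iff, im, im,
    (Matrix.isSymmetric_toEuclideanLin_iff.2 hS.isHermitian).orthogonal_range,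
    (Matrix.isSymmetric_toEuclideanLin_iff.2 (hS.add hT).isHermitian).orthogonal_range]
  intro x hx
  rw [LinearMap.mem_ker] at hx ⊢
  have hx : (S + T).mulVec x.ofLp = 0 := congrArg WithLp.ofLp hx
  have hsum : star x.ofLp ⬝ᵥ S.mulVec x.ofLp + star x.ofLp ⬝ᵥ T.mulVec x.ofLp = 0 := by
    rw [← dotProduct_add, ← Matrix.add_mulVec, hx, dotProduct_zero]
  have hSx : S.mulVec x.ofLp = 0 := (hS.dotProduct_mulVec_zero_iff x.ofLp).1 <| by
    linarith [hS.dotProduct_mulVec_nonneg x.ofLp, hT.dotProduct_mulVec_nonneg x.ofLp]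
  exact congrArg (WithLp.toLp 2) hSx

theorem im_add {S T : Matrix (Fin N) (Fin N) ℝ} (hS : S.PosSemidef) (hT : T.PosSemidef) :
    im (S + T) = im S ⊔ im T := by
  refine le_antisymm ?_ (sup_le (im_le_im_add hS hT) (add_comm S T ▸ im_le_im_add hT hS))
  rw [im, map_add]
  exact LinearMap.range_add_le _ _

end Rank

/-! ### Gaussian measures -/

section StdGaussian

variable (E : Type*) [NormedAddCommGroup E] [InnerProductSpace ℝ E] [FiniteDimensional ℝ E]
  [MeasurableSpace E] [BorelSpace E]

theorem integrable_exp_neg_half_norm_sq :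
    Integrable fun v : E => Real.exp (-(1 / 2) * ‖v‖ ^ 2) := by
  refine Integrable.of_integral_ne_zero ?_
  rw [GaussianFourier.integral_rexp_neg_mul_sq_norm one_half_pos]
  positivity

theorem stdGaussian_eq_withDensity :
    stdGaussian E = volume.withDensity fun v => ENNReal.ofReal
      (((2 * Real.pi) ^ (Module.finrank ℝ E / 2 : ℝ))⁻¹ * Real.exp (-(1 / 2) * ‖v‖ ^ 2)) := by
  set c : ℝ := (2 * Real.pi) ^ (Module.finrank ℝ E / 2 : ℝ) with hc
  have hc0 : (c : ℂ) ≠ 0 := Complex.ofReal_ne_zero.2 (by positivity)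
  have hcpow : ((Real.pi : ℂ) / (1 / 2)) ^ ((Module.finrank ℝ E : ℂ) / 2) = c := by
    rw [hc, Complex.ofReal_cpow (by positivity)]
    push_cast
    congr 1
    ring
  have hint : Integrable fun v : E => c⁻¹ * Real.exp (-(1 / 2) * ‖v‖ ^ 2) :=
    (integrable_exp_neg_half_norm_sq E).const_mul _
  have := isFiniteMeasure_withDensity_ofReal hint.2
  have density_smul_exp (t v : E) :
      (ENNReal.ofReal (c⁻¹ * Real.exp (-(1 / 2) * ‖v‖ ^ 2))).toReal •
          Complex.exp (inner ℝ v t * Complex.I) =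
        (c : ℂ)⁻¹ * Complex.exp (-(1 / 2) * ‖v‖ ^ 2 + Complex.I * inner ℝ t v) := by
    rw [ENNReal.toReal_ofReal (by positivity), Complex.real_smul, Complex.exp_add,
      real_inner_comm, mul_comm Complex.I]
    push_cast
    ring
  refine Measure.ext_of_charFun (funext fun t => ?_)
  rw [charFun_stdGaussian, charFun_apply,
    integral_withDensity_eq_integral_toReal_smul (by fun_prop) (by simp)]
  simp_rw [density_smul_exp]
  rw [integral_const_mul, GaussianFourier.integral_cexp_neg_mul_sq_norm_add (by norm_num), hcpow,
    inv_mul_cancel_left₀ hc0, Complex.I_sq]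
  congr 1
  ring

variable {E} in
theorem stdGaussian_submodule {V : Submodule ℝ E} (hV : V ≠ ⊤) : stdGaussian E V = 0 := by
  rw [stdGaussian_eq_withDensity]
  exact withDensity_absolutelyContinuous _ _ (Measure.addHaar_submodule _ V hV)

end StdGaussian

section MultivariateGaussian

variable {ι κ : Type*} [Fintype ι] [Fintype κ] [DecidableEq ι] [DecidableEq κ]

theorem map_toEuclideanLin_multivariateGaussian (μ : EuclideanSpace ℝ ι) {S : Matrix ι ι ℝ}
    (hS : S.PosSemidef) (φ : Matrix κ ι ℝ) :
    (multivariateGaussian μ S).map (Matrix.toEuclideanLin φ) =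
      multivariateGaussian (Matrix.toEuclideanLin φ μ) (φ * S * φ.transpose) := by
  have hφ : Measurable (Matrix.toEuclideanLin φ) :=
    (LinearMap.continuous_of_finiteDimensional _).measurable
  have hφS : (φ * S * φ.transpose).PosSemidef := hS.mul_mul_conjTranspose_same φ
  have inner_apply (x : EuclideanSpace ℝ ι) (t : EuclideanSpace ℝ κ) :
      inner ℝ (Matrix.toEuclideanLin φ x) t =
        inner ℝ x (Matrix.toEuclideanLin φ.transpose t) := by
    simp [EuclideanSpace.inner_eq_star_dotProduct, Matrix.dotProduct_mulVec,
      Matrix.mulVec_transpose, dotProduct_comm]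
  have := Measure.isProbabilityMeasure_map (μ := multivariateGaussian μ S) hφ.aemeasurable
  refine Measure.ext_of_charFun (funext fun t => ?_)
  calc charFun ((multivariateGaussian μ S).map (Matrix.toEuclideanLin φ)) t
    _ = charFun (multivariateGaussian μ S) (Matrix.toEuclideanLin φ.transpose t) := by
      rw [charFun_apply, integral_map hφ.aemeasurable (by fun_prop), charFun_apply]
      simp_rw [inner_apply]
    _ = _ := by
      rw [charFun_multivariateGaussian hS, charFun_multivariateGaussian hφS,
        ← real_inner_comm, ← inner_apply, real_inner_comm, ← Matrix.mulVec_mulVec,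
        ← Matrix.mulVec_mulVec, Matrix.dotProduct_mulVec t.ofLp, ← Matrix.mulVec_transpose]
      rfl

theorem multivariateGaussian_conv (μ ν : EuclideanSpace ℝ ι) {S T : Matrix ι ι ℝ}
    (hS : S.PosSemidef) (hT : T.PosSemidef) :
    (multivariateGaussian μ S).conv (multivariateGaussian ν T) =
      multivariateGaussian (μ + ν) (S + T) := by
  refine Measure.ext_of_charFun (funext fun t => ?_)
  rw [charFun_conv, charFun_multivariateGaussian hS, charFun_multivariateGaussian hT,
    charFun_multivariateGaussian (hS.add hT), ← Complex.exp_add, inner_add_right,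
    Matrix.add_mulVec, dotProduct_add]
  push_cast
  congr 1
  ring

end MultivariateGaussian

section GaussianDensity

variable {M : ℕ} {K : Matrix (Fin M) (Fin M) ℝ}

theorem measurable_gaussianDensity (K : Matrix (Fin M) (Fin M) ℝ) :
    Measurable (gaussianDensity K) := by
  unfold gaussianDensity
  fun_prop

theorem gaussianDensity_nonneg (K : Matrix (Fin M) (Fin M) ℝ) (y : EuclideanSpace ℝ (Fin M)) :
    0 ≤ gaussianDensity K y := by
  unfold gaussianDensity
  positivity

theorem gaussianDensity_mul_transpose_apply {A : Matrix (Fin M) (Fin M) ℝ} (hA : A.det ≠ 0)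
    (x : EuclideanSpace ℝ (Fin M)) :
    |A.det| * gaussianDensity (A * A.transpose) (Matrix.toEuclideanLin A x) =
      ((2 * Real.pi) ^ (M / 2 : ℝ))⁻¹ * Real.exp (-(1 / 2) * ‖x‖ ^ 2) := by
  have hquad : A.mulVec x.ofLp ⬝ᵥ (A * A.transpose)⁻¹.mulVec (A.mulVec x.ofLp) = ‖x‖ ^ 2 := by
    have hunit := isUnit_iff_ne_zero.2 hA
    have hunit' : IsUnit A.transpose.det := A.det_transpose.symm ▸ hunit
    rw [Matrix.mulVec_mulVec, Matrix.dotProduct_mulVec, Matrix.vecMul_mulVec, Matrix.mul_inv_rev,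
      Matrix.nonsing_inv_mul_cancel_right _ _ hunit, Matrix.mul_nonsing_inv _ hunit',
      Matrix.vecMul_one, EuclideanSpace.real_norm_sq_eq]
    simp only [dotProduct, sq]
  have hsqrt : √((2 * Real.pi) ^ M * (A * A.transpose).det) =
      (2 * Real.pi) ^ (M / 2 : ℝ) * |A.det| := by
    rw [Matrix.det_mul, Matrix.det_transpose, Real.sqrt_mul (by positivity),
      Real.sqrt_mul_self_eq_abs, Real.sqrt_eq_rpow, ← Real.rpow_natCast_mul (by positivity),
      mul_one_div]
  have hdet : |A.det| ≠ 0 := abs_ne_zero.2 hA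
  rw [gaussianDensity, Matrix.ofLp_toLpLin, Matrix.toLin'_apply, hquad, hsqrt]
  field_simp

theorem map_withDensity_det_mul_comp {E : Type*} [NormedAddCommGroup E] [NormedSpace ℝ E]
    [FiniteDimensional ℝ E] [MeasurableSpace E] [BorelSpace E] (μ : Measure E) [μ.IsAddHaarMeasure]
    {T : E →ₗ[ℝ] E} (hT : LinearMap.det T ≠ 0) {f : E → ℝ≥0∞} (hf : Measurable f) :
    (μ.withDensity fun x => ENNReal.ofReal |LinearMap.det T| * f (T x)).map T =
      μ.withDensity f := by
  have hT' : Measurable T := T.continuous_of_finiteDimensional.measurable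
  ext A hA
  rw [Measure.map_apply hT' hA, withDensity_apply _ (hT' hA), withDensity_apply _ hA,
    lintegral_const_mul' _ _ ENNReal.ofReal_ne_top, ← setLIntegral_map hA hf hT',
    Measure.map_linearMap_addHaar_eq_smul_addHaar _ hT, Measure.restrict_smul,
    lintegral_smul_measure, smul_eq_mul, ← mul_assoc, ← ENNReal.ofReal_mul (abs_nonneg _),
    ← abs_mul, mul_inv_cancel₀ hT, abs_one, ENNReal.ofReal_one, one_mul]

theorem multivariateGaussian_mul_transpose_eq_withDensity {A : Matrix (Fin M) (Fin M) ℝ}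
    (hA : A.det ≠ 0) :
    multivariateGaussian 0 (A * A.transpose) =
      volume.withDensity fun y => ENNReal.ofReal (gaussianDensity (A * A.transpose) y) := by
  set T := Matrix.toEuclideanLin A with hT
  have hdet : LinearMap.det T = A.det := by
    rw [hT, Matrix.toEuclideanLin_eq_toLin_orthonormal, LinearMap.det_toLin]
  have hT0 : LinearMap.det T ≠ 0 := by rwa [hdet]
  have hmap := map_withDensity_det_mul_comp (volume : Measure (EuclideanSpace ℝ (Fin M))) hT0
    (measurable_gaussianDensity (A * A.transpose)).ennreal_ofReal
  calc multivariateGaussian 0 (A * A.transpose)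
    _ = (stdGaussian (EuclideanSpace ℝ (Fin M))).map T := by
      rw [← multivariateGaussian_zero_one,
        map_toEuclideanLin_multivariateGaussian 0 Matrix.PosSemidef.one, map_zero, mul_one]
    _ = (volume.withDensity fun x => ENNReal.ofReal |LinearMap.det T| *
          ENNReal.ofReal (gaussianDensity (A * A.transpose) (T x))).map T := by
      simp_rw [hdet, ← ENNReal.ofReal_mul (abs_nonneg _), hT,
        gaussianDensity_mul_transpose_apply hA]
      rw [stdGaussian_eq_withDensity, finrank_euclideanSpace_fin]
    _ = _ := by rw [hmap]

open scoped MatrixOrder Matrix.Norms.L2Operator in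
theorem multivariateGaussian_eq_withDensity (hK : K.PosDef) :
    multivariateGaussian 0 K =
      volume.withDensity fun y => ENNReal.ofReal (gaussianDensity K y) := by
  obtain ⟨B, rfl⟩ := CStarAlgebra.nonneg_iff_eq_star_mul_self.mp hK.posSemidef.nonneg
  have hB : B.transpose.det ≠ 0 := fun h =>
    hK.det_pos.ne' (by rw [Matrix.det_mul, ← B.det_transpose, h, mul_zero])
  have h := multivariateGaussian_mul_transpose_eq_withDensity hB
  rwa [B.transpose_transpose] at h

theorem lintegral_gaussianDensity (hK : K.PosDef) :
    ∫⁻ y, ENNReal.ofReal (gaussianDensity K y) = 1 := by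
  rw [← setLIntegral_univ, ← withDensity_apply _ MeasurableSet.univ,
    ← multivariateGaussian_eq_withDensity hK, measure_univ]

theorem lintegral_exp_neg_quadratic (hK : K.PosDef) :
    ∫⁻ y : EuclideanSpace ℝ (Fin M),
        ENNReal.ofReal (Real.exp (-(y.ofLp ⬝ᵥ K.mulVec y.ofLp) / 2)) =
      ENNReal.ofReal √((2 * Real.pi) ^ M / K.det) := by
  have hdet := hK.det_pos
  have hexp (y : EuclideanSpace ℝ (Fin M)) : Real.exp (-(y.ofLp ⬝ᵥ K.mulVec y.ofLp) / 2) =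
      √((2 * Real.pi) ^ M / K.det) * gaussianDensity K⁻¹ y := by
    rw [gaussianDensity, Matrix.nonsing_inv_nonsing_inv _ (isUnit_iff_ne_zero.2 hdet.ne'),
      Matrix.det_nonsing_inv, Ring.inverse_eq_inv', ← div_eq_mul_inv,
      mul_inv_cancel_left₀ (by positivity)]
  simp_rw [hexp, ENNReal.ofReal_mul (Real.sqrt_nonneg _)]
  rw [lintegral_const_mul _ (measurable_gaussianDensity _).ennreal_ofReal,
    lintegral_gaussianDensity hK.inv, mul_one]

end GaussianDensity

/-! ### Random subspaces -/

section RandomSubspace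

variable {N : ℕ}

theorem span_range_starProjection {ι E : Type*} [NormedAddCommGroup E] [InnerProductSpace ℝ E]
    (V : Submodule ℝ E) [V.HasOrthogonalProjection] (b : Module.Basis ι ℝ E) :
    Submodule.span ℝ (Set.range fun a => V.starProjection (b a)) = V := by
  have h := Submodule.map_span (V.starProjection : E →ₗ[ℝ] E) (Set.range b)
  rw [b.span_eq, Submodule.map_top, ← Set.range_comp] at h
  exact h.symm.trans V.range_starProjection

theorem measurable_finrank_sup {Ω : Type*} [MeasurableSpace Ω]
    {V W : Ω → Submodule ℝ (EuclideanSpace ℝ (Fin N))} (hV : Measurable V) (hW : Measurable W) :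
    Measurable fun ω => Module.finrank ℝ
      (V ω ⊔ W ω : Submodule ℝ (EuclideanSpace ℝ (Fin N))) := by
  let b := (EuclideanSpace.basisFun (Fin N) ℝ).toBasis
  have h := measurable_finrank_span_sup_span
    (measurable_pi_iff.2 fun a => measurable_subspace_iff.1 hV (b a))
    (measurable_pi_iff.2 fun a => measurable_subspace_iff.1 hW (b a))
  have finrank_eq (ω : Ω) : Module.finrank ℝ (V ω ⊔ W ω : Submodule ℝ (EuclideanSpace ℝ (Fin N))) =
      Module.finrank ℝ (Submodule.span ℝ (Set.range fun a => (V ω).starProjection (b a)) ⊔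
        Submodule.span ℝ (Set.range fun a => (W ω).starProjection (b a)) :
          Submodule ℝ (EuclideanSpace ℝ (Fin N))) := by
    rw [span_range_starProjection, span_range_starProjection]
  simp_rw [finrank_eq]
  exact h

theorem ae_finrank_sup_grassmannUniform (W : Submodule ℝ (EuclideanSpace ℝ (Fin N))) (r : ℕ) :
    ∀ᵐ V ∂grassmannUniform N r,
      Module.finrank ℝ (W ⊔ V : Submodule ℝ (EuclideanSpace ℝ (Fin N))) =
        min (Module.finrank ℝ W + r) N := by
  have hmeas : Measurable fun V : Submodule ℝ (EuclideanSpace ℝ (Fin N)) =>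
      Module.finrank ℝ (W ⊔ V : Submodule ℝ (EuclideanSpace ℝ (Fin N))) :=
    measurable_finrank_sup measurable_const measurable_id
  rw [grassmannUniform, ae_map_iff (measurable_span N r).aemeasurable
    (measurableSet_eq_fun hmeas measurable_const)]
  have h := ae_finrank_sup_span_eq (fun V => stdGaussian_submodule (V := V)) W r
  rwa [finrank_euclideanSpace_fin] at h

theorem ae_finrank_sup_of_indepFun {Ω : Type*} [MeasurableSpace Ω] {P : Measure Ω}
    [IsFiniteMeasure P] {W V : Ω → Submodule ℝ (EuclideanSpace ℝ (Fin N))} {r : ℕ}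
    (hW : AEMeasurable W P) (hV : HasPDF V P (grassmannUniform N r)) (hWV : IndepFun W V P) :
    ∀ᵐ ω ∂P, Module.finrank ℝ (W ω ⊔ V ω : Submodule ℝ (EuclideanSpace ℝ (Fin N))) =
      min (Module.finrank ℝ (W ω) + r) N := by
  have hfinrank : Measurable fun U : Submodule ℝ (EuclideanSpace ℝ (Fin N)) =>
      Module.finrank ℝ U := by
    convert measurable_finrank_sup measurable_id measurable_id using 2 with U
    rw [id, sup_idem]
  have hmeas : MeasurableSet {q : Submodule ℝ (EuclideanSpace ℝ (Fin N)) × Submodule ℝ _ |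
      Module.finrank ℝ (q.1 ⊔ q.2 : Submodule ℝ (EuclideanSpace ℝ (Fin N))) =
        min (Module.finrank ℝ q.1 + r) N} :=
    measurableSet_eq_fun (measurable_finrank_sup measurable_fst measurable_snd)
      (((hfinrank.comp measurable_fst).add_const r).min measurable_const)
  refine ae_of_ae_map (p := fun q => Module.finrank ℝ
    (q.1 ⊔ q.2 : Submodule ℝ (EuclideanSpace ℝ (Fin N))) =
      min (Module.finrank ℝ q.1 + r) N) (hW.prodMk hV.aemeasurable) ?_
  rw [(indepFun_iff_map_prod_eq_prod_map_map hW hV.aemeasurable).1 hWV,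
    Measure.ae_prod_iff_ae_ae hmeas]
  exact Eventually.of_forall fun U =>
    (HasPDF.absolutelyContinuous (X := V)).ae_le (ae_finrank_sup_grassmannUniform U r)

theorem dimGap_eq_finrank_sup (V W : Submodule ℝ (EuclideanSpace ℝ (Fin N))) :
    dimGap V W =
      2 * Module.finrank ℝ (V ⊔ W : Submodule ℝ _) - Module.finrank ℝ V - Module.finrank ℝ W := by
  have := Submodule.finrank_sup_add_finrank_inf_eq V W
  rw [dimGap]
  omega

end RandomSubspace

/-! ### Determinants under small perturbations -/

section Determinant

variable {n : Type*} [Fintype n] [DecidableEq n] {A : Matrix n n ℝ}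

theorem det_add_smul_one_eq_prod (hA : A.IsHermitian) (s : ℝ) :
    (A + s • (1 : Matrix n n ℝ)).det = ∏ k, (hA.eigenvalues k + s) := by
  have hneg : Matrix.scalar n (-s) - A = -(A + s • (1 : Matrix n n ℝ)) := by
    rw [Matrix.scalar_apply, ← Matrix.smul_one_eq_diagonal, neg_smul]
    abel
  have h := congrArg (Polynomial.eval (-s)) hA.charpoly_eq
  rw [Matrix.eval_charpoly, hneg, Matrix.det_neg, Polynomial.eval_prod] at h
  have heval (k : n) : Polynomial.eval (-s)
      (Polynomial.X - Polynomial.C ((hA.eigenvalues k : ℝ) : ℝ)) = -(hA.eigenvalues k + s) := by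
    rw [Polynomial.eval_sub, Polynomial.eval_X, Polynomial.eval_C]
    ring
  simp only [RCLike.ofReal_real_eq_id, id, heval, Finset.prod_neg, Finset.card_univ] at h
  exact mul_left_cancel₀ (pow_ne_zero _ (by norm_num)) h

theorem isTheta_const_add_self (a : ℝ) :
    (fun s => a + s) =Θ[𝓝[>] 0] fun s : ℝ => s ^ (if a = 0 then 1 else 0) := by
  split_ifs with ha
  · simpa [ha] using Asymptotics.isTheta_rfl
  · have h : Tendsto (fun s => a + s) (𝓝[>] 0) (𝓝 (a + 0)) :=
      (tendsto_id.mono_left nhdsWithin_le_nhds).const_add a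
    rw [add_zero] at h
    simp_rw [pow_zero]
    exact ((Asymptotics.isEquivalent_const_iff_tendsto ha).2 h).isTheta.trans
      (Asymptotics.isTheta_const_const ha one_ne_zero)

theorem isTheta_det_add_smul_one (hA : A.IsHermitian) :
    (fun s => (A + s • (1 : Matrix n n ℝ)).det) =Θ[𝓝[>] 0]
      fun s : ℝ => s ^ (Fintype.card n - A.rank) := by
  have hcard : ∑ k, (if hA.eigenvalues k = 0 then 1 else 0) = Fintype.card n - A.rank := by
    rw [hA.rank_eq_card_non_zero_eigs, Finset.sum_boole, Nat.cast_id, ← Fintype.card_subtype,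
      Fintype.card_subtype_compl]
    have := Fintype.card_subtype_le fun k => hA.eigenvalues k = 0
    omega
  simp_rw [det_add_smul_one_eq_prod hA, ← hcard, ← Finset.prod_pow_eq_pow_sum]
  exact Asymptotics.IsTheta.finsetProd fun k _ => isTheta_const_add_self _

end Determinant

/-! ### Overlap of Gaussian densities -/

section Overlap

variable {M : ℕ} {K₁ K₂ : Matrix (Fin M) (Fin M) ℝ}

theorem det_inv_add_inv {n 𝕜 : Type*} [Fintype n] [DecidableEq n] [Field 𝕜] {A B : Matrix n n 𝕜}
    (hA : A.det ≠ 0) (hB : B.det ≠ 0) : (A⁻¹ + B⁻¹).det = (A + B).det / (A.det * B.det) := by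
  have factor : A⁻¹ + B⁻¹ = A⁻¹ * (A + B) * B⁻¹ := by
    rw [Matrix.mul_add, Matrix.nonsing_inv_mul _ hA.isUnit, Matrix.add_mul, Matrix.one_mul,
      Matrix.mul_nonsing_inv_cancel_right _ _ hB.isUnit, add_comm]
  rw [factor, Matrix.det_mul, Matrix.det_mul, Matrix.det_nonsing_inv, Matrix.det_nonsing_inv,
    Ring.inverse_eq_inv']
  field_simp

theorem gaussianDensity_mul_gaussianDensity (h₁ : 0 < K₁.det) (y : EuclideanSpace ℝ (Fin M)) :
    gaussianDensity K₁ y * gaussianDensity K₂ y = ((2 * Real.pi) ^ M * √(K₁.det * K₂.det))⁻¹ *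
      Real.exp (-(y.ofLp ⬝ᵥ (K₁⁻¹ + K₂⁻¹).mulVec y.ofLp) / 2) := by
  have hsqrt : √((2 * Real.pi) ^ M * K₁.det) * √((2 * Real.pi) ^ M * K₂.det) =
      (2 * Real.pi) ^ M * √(K₁.det * K₂.det) := by
    rw [← Real.sqrt_mul (by positivity), mul_mul_mul_comm, Real.sqrt_mul (by positivity),
      Real.sqrt_mul_self (by positivity)]
  rw [gaussianDensity, gaussianDensity, mul_mul_mul_comm, ← mul_inv, hsqrt, ← Real.exp_add,
    Matrix.add_mulVec, dotProduct_add, neg_add, add_div]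

theorem sqrt_gaussianDensity_mul_gaussianDensity (h₁ : 0 < K₁.det) (y : EuclideanSpace ℝ (Fin M)) :
    √(gaussianDensity K₁ y * gaussianDensity K₂ y) = √((2 * Real.pi) ^ M * √(K₁.det * K₂.det))⁻¹ *
      Real.exp (-(y.ofLp ⬝ᵥ ((1 / 2 : ℝ) • (K₁⁻¹ + K₂⁻¹)).mulVec y.ofLp) / 2) := by
  rw [gaussianDensity_mul_gaussianDensity h₁, Real.sqrt_mul (by positivity), ← Real.exp_half,
    Matrix.smul_mulVec, dotProduct_smul, smul_eq_mul]
  ring_nf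

theorem lintegral_sqrt_mul_gaussianDensity (h₁ : K₁.PosDef) (h₂ : K₂.PosDef) :
    ∫⁻ y, ENNReal.ofReal √(gaussianDensity K₁ y * gaussianDensity K₂ y) =
      ENNReal.ofReal √(2 ^ M * √(K₁.det * K₂.det) / (K₁ + K₂).det) := by
  have d₁ := h₁.det_pos
  have d₂ := h₂.det_pos
  have hhalf : ((1 / 2 : ℝ) • (K₁⁻¹ + K₂⁻¹)).PosDef := (h₁.inv.add h₂.inv).smul one_half_pos
  have hdet : ((1 / 2 : ℝ) • (K₁⁻¹ + K₂⁻¹)).det =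
      (K₁ + K₂).det / (2 ^ M * √(K₁.det * K₂.det) ^ 2) := by
    rw [Matrix.det_smul, det_inv_add_inv d₁.ne' d₂.ne', Fintype.card_fin,
      Real.sq_sqrt (by positivity), one_div, inv_pow, ← div_eq_inv_mul, div_div, mul_comm (2 ^ M)]
  simp_rw [sqrt_gaussianDensity_mul_gaussianDensity d₁, ENNReal.ofReal_mul (Real.sqrt_nonneg _)]
  rw [lintegral_const_mul' _ _ ENNReal.ofReal_ne_top, lintegral_exp_neg_quadratic hhalf,
    ← ENNReal.ofReal_mul (Real.sqrt_nonneg _), ← Real.sqrt_mul (by positivity), hdet]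
  have : 0 < √(K₁.det * K₂.det) := by positivity
  have := (h₁.add h₂).det_pos
  congr 2
  field_simp

theorem le_gaussianDensity {K Q : Matrix (Fin M) (Fin M) ℝ} (hK : 0 < K.det) (hQ : Q.PosSemidef)
    {m : ℝ} (hm : K.det ≤ m) (y : EuclideanSpace ℝ (Fin M)) :
    (√((2 * Real.pi) ^ M * m))⁻¹ * Real.exp (-(y.ofLp ⬝ᵥ (K⁻¹ + Q).mulVec y.ofLp) / 2) ≤
      gaussianDensity K y := by
  have hquad : 0 ≤ y.ofLp ⬝ᵥ Q.mulVec y.ofLp := hQ.dotProduct_mulVec_nonneg y.ofLp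
  rw [gaussianDensity, Matrix.add_mulVec, dotProduct_add]
  gcongr
  exact le_add_of_nonneg_right hquad

theorem le_lintegral_min_gaussianDensity (h₁ : K₁.PosDef) (h₂ : K₂.PosDef) :
    ENNReal.ofReal √(min K₁.det K₂.det / (K₁ + K₂).det) ≤
      ∫⁻ y, ENNReal.ofReal (min (gaussianDensity K₁ y) (gaussianDensity K₂ y)) := by
  have d₁ := h₁.det_pos
  have d₂ := h₂.det_pos
  have : 0 < max K₁.det K₂.det := lt_max_of_lt_left d₁
  have hconst : √(min K₁.det K₂.det / (K₁ + K₂).det) =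
      (√((2 * Real.pi) ^ M * max K₁.det K₂.det))⁻¹ *
        √((2 * Real.pi) ^ M / (K₁⁻¹ + K₂⁻¹).det) := by
    rw [← Real.sqrt_inv, ← Real.sqrt_mul (by positivity), det_inv_add_inv d₁.ne' d₂.ne',
      ← max_mul_min K₁.det K₂.det]
    congr 1
    field_simp
  rw [hconst, ENNReal.ofReal_mul (by positivity), ← lintegral_exp_neg_quadratic (h₁.inv.add h₂.inv),
    ← lintegral_const_mul' _ _ ENNReal.ofReal_ne_top]
  refine lintegral_mono fun y => ?_
  rw [← ENNReal.ofReal_mul (by positivity)]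
  refine ENNReal.ofReal_le_ofReal (le_min ?_ ?_)
  · exact le_gaussianDensity d₁ h₂.inv.posSemidef (le_max_left _ _) y
  · rw [add_comm K₁⁻¹]
    exact le_gaussianDensity d₂ h₁.inv.posSemidef (le_max_right _ _) y

theorem lintegral_min_gaussianDensity_le (h₁ : K₁.PosDef) (h₂ : K₂.PosDef) :
    ∫⁻ y, ENNReal.ofReal (min (gaussianDensity K₁ y) (gaussianDensity K₂ y)) ≤
      ENNReal.ofReal √(2 ^ M * √(K₁.det * K₂.det) / (K₁ + K₂).det) := by
  rw [← lintegral_sqrt_mul_gaussianDensity h₁ h₂]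
  refine lintegral_mono fun y => ENNReal.ofReal_le_ofReal (Real.le_sqrt_of_sq_le ?_)
  have hmin : 0 ≤ min (gaussianDensity K₁ y) (gaussianDensity K₂ y) :=
    le_min (gaussianDensity_nonneg K₁ y) (gaussianDensity_nonneg K₂ y)
  rw [sq]
  exact mul_le_mul (min_le_left _ _) (min_le_right _ _) hmin (gaussianDensity_nonneg K₁ y)

end Overlap

/-! ### Error of a maximizing classifier -/

section Classifier

variable {ι α : Type*} [Fintype ι] [MeasurableSpace ι] [MeasurableSingletonClass ι]
  [MeasurableSpace α] {μ : Measure α} {f : ι → α → ℝ≥0∞} {c : α → ι}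

theorem sum_setLIntegral_ne_le [DecidableEq ι] (hf : ∀ i, Measurable (f i)) (hc : Measurable c)
    (hmax : ∀ y i, f i y ≤ f (c y) y) :
    ∑ i, ∫⁻ y in {y | c y ≠ i}, f i y ∂μ ≤
      ∑ i, ∑ j ∈ Finset.univ.erase i, ∫⁻ y, min (f i y) (f j y) ∂μ := by
  refine Finset.sum_le_sum fun i _ => ?_
  have hmeas : MeasurableSet {y | c y ≠ i} := (hc (measurableSet_singleton i)).compl
  rw [← lintegral_finsetSum _ fun j _ => (hf i).min (hf j)]
  refine (setLIntegral_mono' hmeas fun y hy => ?_).trans (setLIntegral_le_lintegral _ _)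
  calc f i y
    _ = min (f i y) (f (c y) y) := (min_eq_left (hmax y i)).symm
    _ ≤ ∑ j ∈ Finset.univ.erase i, min (f i y) (f j y) :=
      Finset.single_le_sum (f := fun j => min (f i y) (f j y)) (fun _ _ => zero_le)
        (Finset.mem_erase.2 ⟨hy, Finset.mem_univ _⟩)

theorem lintegral_min_le_sum_setLIntegral_ne (hc : Measurable c) {i j : ι} (hij : i ≠ j) :
    ∫⁻ y, min (f i y) (f j y) ∂μ ≤ ∑ k, ∫⁻ y in {y | c y ≠ k}, f k y ∂μ := by
  classical
  have hmeas : MeasurableSet {y | c y ≠ i} := (hc (measurableSet_singleton i)).compl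
  have hsubset : {y | c y ≠ i}ᶜ ⊆ {y | c y ≠ j} := fun y hy => by
    rw [Set.mem_compl_iff, Set.mem_ofPred_eq, not_not] at hy
    exact (hy.trans_ne hij :)
  calc ∫⁻ y, min (f i y) (f j y) ∂μ
    _ = ∫⁻ y in {y | c y ≠ i}, min (f i y) (f j y) ∂μ +
        ∫⁻ y in {y | c y ≠ i}ᶜ, min (f i y) (f j y) ∂μ := (lintegral_add_compl _ hmeas).symm
    _ ≤ ∫⁻ y in {y | c y ≠ i}, f i y ∂μ + ∫⁻ y in {y | c y ≠ j}, f j y ∂μ :=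
      add_le_add (lintegral_mono fun _ => min_le_left _ _)
        ((lintegral_mono_set hsubset).trans (lintegral_mono fun _ => min_le_right _ _))
    _ = ∑ k ∈ {i, j}, ∫⁻ y in {y | c y ≠ k}, f k y ∂μ :=
      (Finset.sum_pair (f := fun k => ∫⁻ y in {y | c y ≠ k}, f k y ∂μ) hij).symm
    _ ≤ ∑ k, ∫⁻ y in {y | c y ≠ k}, f k y ∂μ :=
      Finset.sum_le_sum_of_subset (Finset.subset_univ _)

end Classifier

/-! ### Measurements and misclassification probability -/

section Overlap

variable {M N : ℕ} {φ : Matrix (Fin M) (Fin N) ℝ} {S T : Matrix (Fin N) (Fin N) ℝ} {s : ℝ}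

/-- The covariance `Φ S Φᵀ + s I` of the measurement of a source with covariance `S` in noise of
variance `s`. -/
def measurementCov (φ : Matrix (Fin M) (Fin N) ℝ) (S : Matrix (Fin N) (Fin N) ℝ) (s : ℝ) :
    Matrix (Fin M) (Fin M) ℝ :=
  φ * S * φ.transpose + s • 1

theorem posDef_measurementCov (φ : Matrix (Fin M) (Fin N) ℝ) (hS : S.PosSemidef) (hs : 0 < s) :
    (measurementCov φ S s).PosDef :=
  Matrix.PosDef.posSemidef_add (hS.mul_mul_conjTranspose_same φ) (Matrix.PosDef.one.smul hs)

theorem measurementCov_add (φ : Matrix (Fin M) (Fin N) ℝ) (S T : Matrix (Fin N) (Fin N) ℝ)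
    (s : ℝ) : measurementCov φ S s + measurementCov φ T s = measurementCov φ (S + T) (2 * s) := by
  rw [measurementCov, measurementCov, measurementCov, add_add_add_comm, two_mul, add_smul,
    Matrix.mul_add, Matrix.add_mul]

theorem measurementLaw_eq_multivariateGaussian (φ : Matrix (Fin M) (Fin N) ℝ)
    (hS : S.PosSemidef) (hs : 0 ≤ s) :
    measurementLaw φ S s = multivariateGaussian 0 (measurementCov φ S s) := by
  have hφ : Measurable (Matrix.toEuclideanLin φ) :=
    (LinearMap.continuous_of_finiteDimensional _).measurable
  have hφS : (φ * S * φ.transpose).PosSemidef := hS.mul_mul_conjTranspose_same φ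
  have hnoise : (s • (1 : Matrix (Fin M) (Fin M) ℝ)).PosSemidef := Matrix.PosSemidef.one.smul hs
  have hconv : measurementLaw φ S s =
      ((multivariateGaussian 0 S).map (Matrix.toEuclideanLin φ)).conv
        (multivariateGaussian 0 (s • (1 : Matrix (Fin M) (Fin M) ℝ))) := by
    rw [measurementLaw, Measure.conv]
    nth_rw 2 [← Measure.map_id (μ := multivariateGaussian 0 (s • (1 : Matrix (Fin M) (Fin M) ℝ)))]
    rw [Measure.map_prod_map _ _ hφ measurable_id,
      Measure.map_map (by fun_prop) (hφ.prodMap measurable_id)]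
    rfl
  rw [hconv, map_toEuclideanLin_multivariateGaussian 0 hS, map_zero,
    multivariateGaussian_conv 0 0 hφS hnoise, add_zero, measurementCov]

theorem measurementLaw_eq_withDensity (φ : Matrix (Fin M) (Fin N) ℝ) (hS : S.PosSemidef)
    (hs : 0 < s) :
    measurementLaw φ S s = volume.withDensity fun y => ENNReal.ofReal (condDensity φ S s y) := by
  rw [measurementLaw_eq_multivariateGaussian φ hS hs.le,
    multivariateGaussian_eq_withDensity (posDef_measurementCov φ hS hs)]
  rfl

/-- The overlap `∫ min (a p(y | S)) (b p(y | T)) dy` of the densities of the measurements of two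
sources with covariances `S` and `T`, weighted by `a` and `b`. -/
noncomputable def overlap (a b : ℝ≥0∞) (φ : Matrix (Fin M) (Fin N) ℝ)
    (S T : Matrix (Fin N) (Fin N) ℝ) (s : ℝ) : ℝ≥0∞ :=
  ∫⁻ y, min (a * ENNReal.ofReal (condDensity φ S s y)) (b * ENNReal.ofReal (condDensity φ T s y))

theorem overlap_eq_zero {a b : ℝ≥0∞} (hab : a = 0 ∨ b = 0) (φ : Matrix (Fin M) (Fin N) ℝ)
    (S T : Matrix (Fin N) (Fin N) ℝ) (s : ℝ) : overlap a b φ S T s = 0 := by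
  obtain rfl | rfl := hab <;> simp [overlap]

theorem overlap_le {a b : ℝ≥0∞} (ha : a ≤ 1) (hb : b ≤ 1) (hS : S.PosSemidef) (hT : T.PosSemidef)
    (hs : 0 < s) :
    overlap a b φ S T s ≤ ENNReal.ofReal
      √(2 ^ M * √((measurementCov φ S s).det * (measurementCov φ T s).det) /
        (measurementCov φ (S + T) (2 * s)).det) := by
  rw [← measurementCov_add]
  refine le_trans (lintegral_mono fun y => ?_) <| lintegral_min_gaussianDensity_le
    (posDef_measurementCov φ hS hs) (posDef_measurementCov φ hT hs)
  rw [ENNReal.ofReal_min]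
  exact min_le_min (mul_le_of_le_one_left' ha) (mul_le_of_le_one_left' hb)

theorem le_overlap {a b : ℝ≥0∞} (hS : S.PosSemidef) (hT : T.PosSemidef) (hs : 0 < s) :
    min a b * ENNReal.ofReal
        √(min (measurementCov φ S s).det (measurementCov φ T s).det /
          (measurementCov φ (S + T) (2 * s)).det) ≤
      overlap a b φ S T s := by
  rw [← measurementCov_add]
  refine (mul_le_mul_right (le_lintegral_min_gaussianDensity (posDef_measurementCov φ hS hs)
    (posDef_measurementCov φ hT hs)) _).trans ?_
  rw [← lintegral_const_mul _ (((measurable_gaussianDensity _).min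
    (measurable_gaussianDensity _)).ennreal_ofReal)]
  refine lintegral_mono fun y => ?_
  rw [ENNReal.ofReal_min]
  exact le_min (mul_le_mul' (min_le_left _ _) (min_le_left _ _))
    (mul_le_mul' (min_le_right _ _) (min_le_right _ _))

end Overlap

section Error

variable {L M N : ℕ} {φ : Matrix (Fin M) (Fin N) ℝ} {s : ℝ} {p : PMF (Fin L)}
  {S : Fin L → Matrix (Fin N) (Fin N) ℝ} {c : EuclideanSpace ℝ (Fin M) → Fin L}

theorem measurable_condDensity (φ : Matrix (Fin M) (Fin N) ℝ) (S : Matrix (Fin N) (Fin N) ℝ)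
    (s : ℝ) : Measurable (condDensity φ S s) :=
  measurable_gaussianDensity _

theorem errorProb_eq_sum_setLIntegral (hS : ∀ i, (S i).PosSemidef) (hs : 0 < s)
    (hc : Measurable c) :
    errorProb p S φ s c = ∑ i, ∫⁻ y in {y | c y ≠ i},
      p i * ENNReal.ofReal (condDensity φ (S i) s y) := by
  refine Finset.sum_congr rfl fun i _ => ?_
  have hmeas : MeasurableSet {y | c y ≠ i} := (hc (measurableSet_singleton i)).compl
  rw [measurementLaw_eq_withDensity φ (hS i) hs, withDensity_apply _ hmeas,
    lintegral_const_mul _ (measurable_condDensity φ (S i) s).ennreal_ofReal]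

theorem errorProb_le_sum_overlap (hS : ∀ i, (S i).PosSemidef) (hs : 0 < s)
    (hc : IsMAP p S φ s c) :
    errorProb p S φ s c ≤
      ∑ i, ∑ j ∈ Finset.univ.erase i, overlap (p i) (p j) φ (S i) (S j) s := by
  rw [errorProb_eq_sum_setLIntegral hS hs hc.measurable]
  refine sum_setLIntegral_ne_le
    (fun i => (measurable_condDensity φ (S i) s).ennreal_ofReal.const_mul (p i))
    hc.measurable fun y i => ?_
  have hle := ENNReal.ofReal_le_ofReal (hc.le y i)
  rwa [ENNReal.ofReal_mul' ENNReal.toReal_nonneg, ENNReal.ofReal_mul' ENNReal.toReal_nonneg,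
    ENNReal.ofReal_toReal (p.apply_ne_top _), ENNReal.ofReal_toReal (p.apply_ne_top _),
    mul_comm, mul_comm _ (p (c y))] at hle

theorem overlap_le_errorProb (hS : ∀ i, (S i).PosSemidef) (hs : 0 < s) (hc : Measurable c)
    {i j : Fin L} (hij : i ≠ j) :
    overlap (p i) (p j) φ (S i) (S j) s ≤ errorProb p S φ s c := by
  rw [errorProb_eq_sum_setLIntegral hS hs hc]
  exact lintegral_min_le_sum_setLIntegral_ne
    (f := fun k y => p k * ENNReal.ofReal (condDensity φ (S k) s y)) hc hij

theorem errorProb_eq_zero (hS : ∀ i, (S i).PosSemidef) (hs : 0 < s) (hc : IsMAP p S φ s c)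
    (hp : ∀ i j, i ≠ j → p i = 0 ∨ p j = 0) : errorProb p S φ s c = 0 := by
  refine nonpos_iff_eq_zero.1 ((errorProb_le_sum_overlap hS hs hc).trans_eq ?_)
  exact Finset.sum_eq_zero fun i _ => Finset.sum_eq_zero fun j hj =>
    overlap_eq_zero (hp i j (Finset.ne_of_mem_erase hj).symm) φ (S i) (S j) s

end Error

/-! ### Decay of the misclassification probability -/

section Asymptotic

variable {α : Type*} {l : Filter α} {f g h : α → ℝ}

theorem isBigO_min (hf : f =O[l] h) (hg : g =O[l] h) : (fun x => min (f x) (g x)) =O[l] h := by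
  refine (Asymptotics.IsBigO.of_norm_le fun x => ?_).trans (hf.norm_left.add hg.norm_left)
  obtain hx | hx := min_choice (f x) (g x) <;> rw [hx]
  · exact le_add_of_nonneg_right (norm_nonneg _)
  · exact le_add_of_nonneg_left (norm_nonneg _)

theorem isBigO_min_right (hf : h =O[l] f) (hg : h =O[l] g) :
    h =O[l] fun x => min (f x) (g x) := by
  obtain ⟨a, ha⟩ := hf.bound
  obtain ⟨b, hb⟩ := hg.bound
  refine .of_bound (max a b) ?_
  filter_upwards [ha, hb] with x hax hbx
  obtain hx | hx := min_choice (f x) (g x) <;> rw [hx]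
  · exact hax.trans (by gcongr; exact le_max_left a b)
  · exact hbx.trans (by gcongr; exact le_max_right a b)

theorem isTheta_min (hf : f =Θ[l] h) (hg : g =Θ[l] h) : (fun x => min (f x) (g x)) =Θ[l] h :=
  ⟨isBigO_min hf.1 hg.1, isBigO_min_right hf.2 hg.2⟩

theorem exists_eventually_log_sub_log_le (hfg : f =O[l] g) (hf : ∀ᶠ x in l, f x ≠ 0) :
    ∃ C, ∀ᶠ x in l, Real.log (f x) - Real.log (g x) ≤ C := by
  obtain ⟨C, hC, hbound⟩ := hfg.exists_pos
  refine ⟨Real.log C, ?_⟩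
  filter_upwards [hbound.bound, hf] with x hx hfx
  have hgx : 0 < |g x| := pos_of_mul_pos_right ((abs_pos.2 hfx).trans_le hx) hC.le
  have hlog := Real.log_le_log (abs_pos.2 hfx) hx
  rw [Real.norm_eq_abs, Real.log_mul hC.ne' hgx.ne', Real.log_abs, Real.log_abs] at hlog
  linarith

theorem isBigO_log_sub_log (hfg : f =Θ[l] g) (hf : ∀ᶠ x in l, f x ≠ 0) :
    (fun x => Real.log (f x) - Real.log (g x)) =O[l] fun _ => (1 : ℝ) := by
  have hg : ∀ᶠ x in l, g x ≠ 0 := by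
    filter_upwards [hf, hfg.1.eq_zero_imp] with x hfx hx using fun hgx => hfx (hx hgx)
  obtain ⟨a, ha⟩ := exists_eventually_log_sub_log_le hfg.1 hf
  obtain ⟨b, hb⟩ := exists_eventually_log_sub_log_le hfg.2 hg
  refine .of_bound (max a b) ?_
  filter_upwards [ha, hb] with x hax hbx
  rw [norm_one, mul_one, Real.norm_eq_abs, abs_le]
  constructor <;> linarith [le_max_left a b, le_max_right a b]

end Asymptotic

theorem isTheta_sqrt_div_of_isTheta_pow {f g : ℝ → ℝ} {a b : ℕ}
    (hf : f =Θ[𝓝[>] 0] fun s => s ^ a) (hg : g =Θ[𝓝[>] 0] fun s => s ^ b)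
    (hf₀ : ∀ s, 0 < s → 0 ≤ f s) (hg₀ : ∀ s, 0 < s → 0 ≤ g s) :
    (fun s => √(f s / g s)) =Θ[𝓝[>] 0] fun s => s ^ (((a : ℝ) - b) / 2) := by
  have hdiv : (fun s => f s / g s) =Θ[𝓝[>] 0] fun s => s ^ ((a : ℝ) - b) := by
    refine (hf.div hg).trans_eventuallyEq ?_
    filter_upwards [self_mem_nhdsWithin] with s hs
    rw [Real.rpow_sub hs, Real.rpow_natCast, Real.rpow_natCast]
  refine (hdiv.sqrt ?_ ?_).trans_eventuallyEq ?_
  · filter_upwards [self_mem_nhdsWithin] with s hs using div_nonneg (hf₀ s hs) (hg₀ s hs)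
  · filter_upwards [self_mem_nhdsWithin] with s hs using Real.rpow_nonneg (le_of_lt hs) _
  · filter_upwards [self_mem_nhdsWithin] with s hs
    rw [Real.sqrt_eq_rpow, ← Real.rpow_mul (le_of_lt hs), mul_one_div]

theorem tendsto_log_one_div_nhdsGT_zero :
    Tendsto (fun s : ℝ => Real.log (1 / s)) (𝓝[>] 0) atTop := by
  simp only [one_div]
  exact Real.tendsto_log_atTop.comp tendsto_inv_nhdsGT_zero

theorem tendsto_neg_log_div_of_isTheta_rpow {F : ℝ → ℝ≥0∞} {a : ℝ}
    (hF : (fun s => (F s).toReal) =Θ[𝓝[>] 0] fun s => s ^ a) :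
    Tendsto (fun s : ℝ => -ENNReal.log (F s) / ((Real.log (1 / s) : ℝ) : EReal)) (𝓝[>] 0)
      (𝓝 (a : EReal)) := by
  have hpos : ∀ᶠ s in 𝓝[>] (0 : ℝ), 0 < (F s).toReal := by
    filter_upwards [self_mem_nhdsWithin, hF.2.eq_zero_imp] with s hs hzero
    exact ENNReal.toReal_nonneg.lt_of_ne' fun h => (Real.rpow_pos_of_pos hs a).ne' (hzero h)
  have hbounded := isBigO_log_sub_log hF (hpos.mono fun _ => ne_of_gt)
  have hdivergent : (fun _ => (1 : ℝ)) =o[𝓝[>] 0] fun s : ℝ => Real.log (1 / s) :=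
    (Asymptotics.isLittleO_one_left_iff ℝ).2
      (tendsto_norm_atTop_atTop.comp tendsto_log_one_div_nhdsGT_zero)
  have hreal : Tendsto (fun s => a - (Real.log (F s).toReal - Real.log (s ^ a)) / Real.log (1 / s))
      (𝓝[>] 0) (𝓝 (a - 0)) :=
    (hbounded.trans_isLittleO hdivergent).tendsto_div_nhds_zero.const_sub a
  rw [sub_zero] at hreal
  refine ((continuous_coe_real_ereal.tendsto a).comp hreal).congr' ?_
  filter_upwards [hpos, self_mem_nhdsWithin,
    tendsto_log_one_div_nhdsGT_zero.eventually_ne_atTop 0] with s hFs hs hlog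
  rw [ENNReal.log_pos_real' hFs, ← EReal.coe_neg, ← EReal.coe_div, Function.comp_apply,
    EReal.coe_eq_coe_iff, Real.log_rpow hs]
  rw [one_div, Real.log_inv, neg_ne_zero] at hlog
  rw [one_div, Real.log_inv]
  field_simp
  ring

section Overlap

variable {M N ρ τ : ℕ} {φ : Matrix (Fin M) (Fin N) ℝ} {S T : Matrix (Fin N) (Fin N) ℝ}

theorem isTheta_det_measurementCov (hS : S.PosSemidef) {c : ℝ} (hc : 0 < c) :
    (fun s => (measurementCov φ S (c * s)).det) =Θ[𝓝[>] 0]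
      fun s => s ^ (M - (φ * S * φ.transpose).rank) := by
  have hdet := isTheta_det_add_smul_one (hS.mul_mul_conjTranspose_same φ).isHermitian
  rw [Fintype.card_fin] at hdet
  have hscale : Tendsto (fun s : ℝ => c * s) (𝓝[>] 0) (𝓝[>] 0) := by
    refine tendsto_nhdsWithin_iff.2 ⟨?_, eventually_mem_nhdsWithin.mono fun s hs => mul_pos hc hs⟩
    exact ((continuous_const_mul c).tendsto' 0 0 (mul_zero c)).mono_left nhdsWithin_le_nhds
  have hcomp : (fun s => (measurementCov φ S (c * s)).det) =Θ[𝓝[>] 0]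
      fun s => (c * s) ^ (M - (φ * S * φ.transpose).rank) :=
    ⟨hdet.1.comp_tendsto hscale, hdet.2.comp_tendsto hscale⟩
  simp_rw [mul_pow] at hcomp
  exact hcomp.trans (Asymptotics.isTheta_rfl.const_mul_left (pow_pos hc _).ne')

theorem isTheta_sqrt_div_det_measurementCov {f : ℝ → ℝ} (hS : S.PosSemidef) (hT : T.PosSemidef)
    (hST : (φ * (S + T) * φ.transpose).rank = τ) (hρ : ρ ≤ M)
    (hf : f =Θ[𝓝[>] 0] fun s => s ^ (M - ρ)) (hf₀ : ∀ s, 0 < s → 0 ≤ f s) :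
    (fun s => √(f s / (measurementCov φ (S + T) (2 * s)).det)) =Θ[𝓝[>] 0]
      fun s => s ^ (((τ : ℝ) - ρ) / 2) := by
  have hτ : τ ≤ M := hST ▸ Matrix.rank_le_height _
  have hdet := isTheta_det_measurementCov (φ := φ) (hS.add hT) two_pos
  rw [hST] at hdet
  convert isTheta_sqrt_div_of_isTheta_pow hf hdet hf₀ fun s hs =>
    (posDef_measurementCov φ (hS.add hT) (mul_pos two_pos hs)).det_pos.le using 4
  push_cast [hρ, hτ]
  ring

variable {a b : ℝ≥0∞}

theorem overlap_ne_top (ha : a ≤ 1) (hb : b ≤ 1) (hS : S.PosSemidef) (hT : T.PosSemidef) {s : ℝ}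
    (hs : 0 < s) : overlap a b φ S T s ≠ ⊤ :=
  ne_top_of_le_ne_top ENNReal.ofReal_ne_top (overlap_le ha hb hS hT hs)

theorem isBigO_overlap (ha : a ≤ 1) (hb : b ≤ 1) (hS : S.PosSemidef) (hT : T.PosSemidef)
    (hρS : (φ * S * φ.transpose).rank = ρ) (hρT : (φ * T * φ.transpose).rank = ρ)
    (hτ : (φ * (S + T) * φ.transpose).rank = τ) :
    (fun s => (overlap a b φ S T s).toReal) =O[𝓝[>] 0] fun s => s ^ (((τ : ℝ) - ρ) / 2) := by
  have hdetS := isTheta_det_measurementCov (φ := φ) hS one_pos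
  have hdetT := isTheta_det_measurementCov (φ := φ) hT one_pos
  simp_rw [one_mul, hρS, hρT] at hdetS hdetT
  have hprod : (fun s => 2 ^ M * √((measurementCov φ S s).det * (measurementCov φ T s).det))
      =Θ[𝓝[>] 0] fun s => s ^ (M - ρ) := by
    refine Asymptotics.IsTheta.const_mul_left (by positivity) <|
      ((hdetS.mul hdetT).sqrt ?_ ?_).trans_eventuallyEq ?_
    all_goals filter_upwards [self_mem_nhdsWithin] with s hs
    · exact mul_nonneg (posDef_measurementCov φ hS hs).det_pos.le
        (posDef_measurementCov φ hT hs).det_pos.le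
    · exact mul_self_nonneg _
    · exact Real.sqrt_mul_self (pow_nonneg (le_of_lt hs) _)
  refine Asymptotics.IsBigO.trans (.of_norm_eventuallyLE ?_)
    (isTheta_sqrt_div_det_measurementCov hS hT hτ (hρS ▸ Matrix.rank_le_height _) hprod
      fun s _ => by positivity).1
  filter_upwards [self_mem_nhdsWithin] with s hs
  rw [Real.norm_of_nonneg ENNReal.toReal_nonneg]
  exact ENNReal.toReal_le_of_le_ofReal (Real.sqrt_nonneg _) (overlap_le ha hb hS hT hs)

theorem isBigO_overlap_right (ha : a ≤ 1) (hb : b ≤ 1) (ha₀ : a ≠ 0) (hb₀ : b ≠ 0)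
    (hS : S.PosSemidef) (hT : T.PosSemidef)
    (hρS : (φ * S * φ.transpose).rank = ρ) (hρT : (φ * T * φ.transpose).rank = ρ)
    (hτ : (φ * (S + T) * φ.transpose).rank = τ) :
    (fun s => s ^ (((τ : ℝ) - ρ) / 2)) =O[𝓝[>] 0] fun s => (overlap a b φ S T s).toReal := by
  have hdetS := isTheta_det_measurementCov (φ := φ) hS one_pos
  have hdetT := isTheta_det_measurementCov (φ := φ) hT one_pos
  simp_rw [one_mul, hρS, hρT] at hdetS hdetT
  have hab : (min a b).toReal ≠ 0 :=
    (ENNReal.toReal_pos (min_eq_bot.not.2 (not_or.2 ⟨ha₀, hb₀⟩))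
      (ne_top_of_le_ne_top ENNReal.one_ne_top (min_le_of_left_le ha))).ne'
  have hbound := (isTheta_sqrt_div_det_measurementCov hS hT hτ (hρS ▸ Matrix.rank_le_height _)
    (isTheta_min hdetS hdetT) fun s hs => le_min (posDef_measurementCov φ hS hs).det_pos.le
      (posDef_measurementCov φ hT hs).det_pos.le).const_mul_left hab
  refine hbound.2.trans (.of_norm_eventuallyLE ?_)
  filter_upwards [self_mem_nhdsWithin] with s hs
  have hle := ENNReal.toReal_mono (overlap_ne_top ha hb hS hT hs)
    (le_overlap (φ := φ) (a := a) (b := b) hS hT hs)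
  rw [Real.norm_of_nonneg (by positivity)]
  rwa [ENNReal.toReal_mul, ENNReal.toReal_ofReal (Real.sqrt_nonneg _)] at hle

end Overlap

section Error

variable {L M N ρ τ : ℕ} {φ : Matrix (Fin M) (Fin N) ℝ} {p : PMF (Fin L)}
  {S : Fin L → Matrix (Fin N) (Fin N) ℝ} {c : ℝ → EuclideanSpace ℝ (Fin M) → Fin L}

theorem isTheta_errorProb (hS : ∀ i, (S i).PosSemidef)
    (hρ : ∀ i, (φ * S i * φ.transpose).rank = ρ)
    (hτ : ∀ i j, i ≠ j → (φ * (S i + S j) * φ.transpose).rank = τ)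
    (hc : ∀ s, 0 < s → IsMAP p S φ s (c s)) {i j : Fin L} (hij : i ≠ j) (hi : p i ≠ 0)
    (hj : p j ≠ 0) :
    (fun s => (errorProb p S φ s (c s)).toReal) =Θ[𝓝[>] 0] fun s => s ^ (((τ : ℝ) - ρ) / 2) := by
  have hsum_ne_top {s : ℝ} (hs : 0 < s) (i : Fin L) :
      ∑ j ∈ Finset.univ.erase i, overlap (p i) (p j) φ (S i) (S j) s ≠ ⊤ :=
    ENNReal.sum_ne_top.2 fun j _ =>
      overlap_ne_top (p.coe_le_one i) (p.coe_le_one j) (hS i) (hS j) hs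
  have hle {s : ℝ} (hs : 0 < s) := errorProb_le_sum_overlap hS hs (hc s hs)
  constructor
  · have hsum : (fun s => ∑ i, ∑ j ∈ Finset.univ.erase i,
        (overlap (p i) (p j) φ (S i) (S j) s).toReal) =O[𝓝[>] 0]
          fun s => s ^ (((τ : ℝ) - ρ) / 2) :=
      .fun_sum fun i _ => .fun_sum fun j hj => isBigO_overlap (p.coe_le_one i) (p.coe_le_one j)
        (hS i) (hS j) (hρ i) (hρ j) (hτ i j (Finset.ne_of_mem_erase hj).symm)
    refine .trans (.of_norm_eventuallyLE ?_) hsum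
    filter_upwards [self_mem_nhdsWithin] with s hs
    rw [Real.norm_of_nonneg ENNReal.toReal_nonneg]
    refine (ENNReal.toReal_mono (ENNReal.sum_ne_top.2 fun i _ => hsum_ne_top hs i)
      (hle hs)).trans_eq ?_
    rw [ENNReal.toReal_sum fun i _ => hsum_ne_top hs i]
    exact Finset.sum_congr rfl fun i _ => ENNReal.toReal_sum fun j _ =>
      overlap_ne_top (p.coe_le_one i) (p.coe_le_one j) (hS i) (hS j) hs
  · refine (isBigO_overlap_right (p.coe_le_one i) (p.coe_le_one j) hi hj (hS i) (hS j) (hρ i)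
      (hρ j) (hτ i j hij)).trans (.of_norm_eventuallyLE ?_)
    filter_upwards [self_mem_nhdsWithin] with s hs
    rw [Real.norm_of_nonneg ENNReal.toReal_nonneg]
    exact ENNReal.toReal_mono
      (ne_top_of_le_ne_top (ENNReal.sum_ne_top.2 fun i _ => hsum_ne_top hs i) (hle hs))
      (overlap_le_errorProb hS hs (hc s hs).measurable hij)

theorem exists_tendsto_neg_log_errorProb_div (hS : ∀ i, (S i).PosSemidef)
    (hρ : ∀ i, (φ * S i * φ.transpose).rank = ρ)
    (hτ : ∀ i j, i ≠ j → (φ * (S i + S j) * φ.transpose).rank = τ)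
    (hc : ∀ s, 0 < s → IsMAP p S φ s (c s)) :
    ∃ ℓ : EReal, (((τ : ℝ) - ρ) / 2 : ℝ) ≤ ℓ ∧
      Tendsto (fun s => -ENNReal.log (errorProb p S φ s (c s)) /
        ((Real.log (1 / s) : ℝ) : EReal)) (𝓝[>] 0) (𝓝 ℓ) := by
  by_cases hp : ∀ i j, i ≠ j → p i = 0 ∨ p j = 0
  · refine ⟨⊤, le_top, tendsto_const_nhds.congr' ?_⟩
    filter_upwards [self_mem_nhdsWithin, tendsto_log_one_div_nhdsGT_zero.eventually_gt_atTop 0]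
      with s hs hlog
    rw [errorProb_eq_zero hS hs (hc s hs) hp, ENNReal.log_zero, EReal.neg_bot,
      EReal.top_div_of_pos_ne_top (EReal.coe_pos.2 hlog) (EReal.coe_ne_top _)]
  · push Not at hp
    obtain ⟨i, j, hij, hi, hj⟩ := hp
    exact ⟨_, le_rfl,
      tendsto_neg_log_div_of_isTheta_rpow (isTheta_errorProb hS hρ hτ hc hij hi hj)⟩

end Error

/-! ### Generic dimensions -/

section Generic

variable {ι : Type*} [Countable ι] {N r : ℕ}

theorem ae_finrank_sup_of_pairwise_indepFun {Ω : Type*} [MeasurableSpace Ω] {P : Measure Ω}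
    [IsFiniteMeasure P] {V : ι → Ω → Submodule ℝ (EuclideanSpace ℝ (Fin N))}
    (hrank : ∀ i ω, Module.finrank ℝ (V i ω) = r)
    (hpdf : ∀ i, HasPDF (V i) P (grassmannUniform N r))
    (hindep : ∀ i j, i ≠ j → IndepFun (V i) (V j) P) :
    ∀ᵐ ω ∂P, ∀ i j, i ≠ j → Module.finrank ℝ ↥(V i ω ⊔ V j ω) = min (2 * r) N := by
  refine ae_all_iff.2 fun i => ae_all_iff.2 fun j => eventually_imp_distrib_left.2 fun hij => ?_
  filter_upwards [ae_finrank_sup_of_indepFun (hpdf i).aemeasurable (hpdf j) (hindep i j hij)]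
    with ω hω
  rw [hω, hrank, two_mul]

theorem ae_rank_of_finrank_im {S : ι → Matrix (Fin N) (Fin N) ℝ} {q : ℕ} (M : ℕ)
    (hS : ∀ i, (S i).PosSemidef) (hrank : ∀ i, Module.finrank ℝ (im (S i)) = r)
    (hsup : ∀ i j, i ≠ j → Module.finrank ℝ ↥(im (S i) ⊔ im (S j)) = q) :
    ∀ᵐ φ ∂matrixVolume M N, (∀ i, (φ * S i * φ.transpose).rank = min M r) ∧
      ∀ i j, i ≠ j → (φ * (S i + S j) * φ.transpose).rank = min M q := by
  have hone : ∀ᵐ φ ∂matrixVolume M N, ∀ i, (φ * S i * φ.transpose).rank = min M (S i).rank :=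
    ae_all_iff.2 fun i => ae_rank_mul_mul_transpose_eq M (hS i)
  have htwo : ∀ᵐ φ ∂matrixVolume M N, ∀ i j,
      (φ * (S i + S j) * φ.transpose).rank = min M (S i + S j).rank :=
    ae_all_iff.2 fun i => ae_all_iff.2 fun j =>
      ae_rank_mul_mul_transpose_eq M ((hS i).add (hS j))
  filter_upwards [hone, htwo] with φ hφ₁ hφ₂
  refine ⟨fun i => ?_, fun i j hij => ?_⟩
  · rw [hφ₁, ← finrank_im, hrank]
  · rw [hφ₂, ← finrank_im, im_add (hS i) (hS j), hsup i j hij]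

end Generic

theorem lt_half_sub_generic_ranks {N r M : ℕ} (hrN : r ≤ N) {d₀ : ℝ}
    (hd₀ : d₀ < ((2 * min (N - r) r : ℕ) : ℝ) / 4) (hM : 2 * d₀ + r < M) :
    d₀ < (((min M (min (2 * r) N) : ℕ) : ℝ) - (min M r : ℕ)) / 2 := by
  have hd₀' : 2 * d₀ < (min (N - r) r : ℕ) := by
    push_cast at hd₀ ⊢
    linarith
  obtain hMr | hrM := le_total M r
  · have hτ : min M (min (2 * r) N) = M := by omega
    have hMr' : (M : ℝ) ≤ r := Nat.cast_le.2 hMr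
    rw [hτ, min_eq_left hMr]
    linarith
  · have hτ : min M (min (2 * r) N) = r + min (M - r) (min (N - r) r) := by omega
    rw [hτ, min_eq_right hrM, Nat.cast_add, add_sub_cancel_left, lt_div_iff₀ two_pos, mul_comm,
      Nat.cast_min]
    refine lt_min ?_ hd₀'
    rw [Nat.cast_sub hrM]
    linarith

end GaussClass

theorem proposition2_general {L N r M : ℕ} (p : PMF (Fin L))
    {Ω : Type*} [MeasurableSpace Ω] (P : Measure Ω) [IsFiniteMeasure P]
    (S : Fin L → Ω → Matrix (Fin N) (Fin N) ℝ)
    (hS : ∀ i ω, (S i ω).PosSemidef)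
    (hrank : ∀ i ω, Module.finrank ℝ (GaussClass.im (S i ω)) = r)
    (hpdf : ∀ i, HasPDF (fun ω => GaussClass.im (S i ω)) P (GaussClass.grassmannUniform N r))
    (hindep : ∀ i j, i ≠ j →
      IndepFun (fun ω => GaussClass.im (S i ω)) (fun ω => GaussClass.im (S j ω)) P)
    {Ω' : Type*} [MeasurableSpace Ω'] (Q : Measure Ω')
    (Φ : Ω' → Matrix (Fin M) (Fin N) ℝ) (hΦ : HasPDF Φ Q (GaussClass.matrixVolume M N))
    (d₀ : ℝ) (hd₀ : d₀ < ((2 * min (N - r) r : ℕ) : ℝ) / 4) (hM : 2 * d₀ + r < M) :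
    ∀ᵐ ω ∂P,
      (∀ i j, i ≠ j →
        GaussClass.dimGap (GaussClass.im (S i ω)) (GaussClass.im (S j ω)) =
          ((2 * min (N - r) r : ℕ) : ℤ)) ∧
      ∀ᵐ ω' ∂Q,
        ∀ c : ℝ → EuclideanSpace ℝ (Fin M) → Fin L,
          (∀ s, 0 < s → GaussClass.IsMAP p (fun i => S i ω) (Φ ω') s (c s)) →
          ∃ ℓ : EReal, (d₀ : EReal) < ℓ ∧
            Tendsto
              (fun s : ℝ =>
                -ENNReal.log (GaussClass.errorProb p (fun i => S i ω) (Φ ω') s (c s)) /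
                  ((Real.log (1 / s) : ℝ) : EReal))
              (𝓝[>] 0) (𝓝 ℓ) := by
  filter_upwards [GaussClass.ae_finrank_sup_of_pairwise_indepFun hrank hpdf hindep] with ω hsup
  obtain ⟨i₀, -⟩ := p.support_nonempty
  have hrN : r ≤ N := by
    simpa [hrank] using Submodule.finrank_le (GaussClass.im (S i₀ ω))
  refine ⟨fun i j hij => ?_, ?_⟩
  · rw [GaussClass.dimGap_eq_finrank_sup, hsup i j hij, hrank, hrank]
    omega
  · filter_upwards [ae_of_ae_map hΦ.aemeasurable (HasPDF.absolutelyContinuous.ae_le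
      (GaussClass.ae_rank_of_finrank_im M (fun i => hS i ω) (fun i => hrank i ω) hsup))]
      with ω' ⟨hρ, hτ⟩ c hc
    obtain ⟨ℓ, hℓ, hlim⟩ :=
      GaussClass.exists_tendsto_neg_log_errorProb_div (fun i => hS i ω) hρ hτ hc
    have hexp := GaussClass.lt_half_sub_generic_ranks hrN hd₀ hM
    exact ⟨ℓ, (EReal.coe_lt_coe hexp).trans_le hℓ, hlim⟩

theorem proposition2 {L N r M : ℕ} (hrN : r < N)
    -- class priors
    (p : PMF (Fin L))
    -- random source covariances of rank `r`, whose images are independent with a density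
    {Ω : Type*} [MeasurableSpace Ω] (P : Measure Ω) [IsProbabilityMeasure P]
    (S : Fin L → Ω → Matrix (Fin N) (Fin N) ℝ)
    (hS : ∀ i ω, (S i ω).PosSemidef)
    (hrank : ∀ i ω, Module.finrank ℝ (GaussClass.im (S i ω)) = r)
    (hpdf : ∀ i, HasPDF (fun ω => GaussClass.im (S i ω)) P (GaussClass.grassmannUniform N r))
    (hindep : iIndepFun (fun i ω => GaussClass.im (S i ω)) P)
    -- random left rotation-invariant measurement matrix
    {Ω' : Type*} [MeasurableSpace Ω'] (Q : Measure Ω') [IsProbabilityMeasure Q]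
    (Φ : Ω' → Matrix (Fin M) (Fin N) ℝ)
    (hΦ : GaussClass.LeftRotationInvariant Q Φ)
    (d₀ : ℝ) (hd₀ : d₀ < ((2 * min (N - r) r : ℕ) : ℝ) / 4)
    (hM : (M : ℤ) = ⌊2 * d₀ + (r : ℝ)⌋ + 1) :
    ∀ᵐ ω ∂P,
      (∀ i j, i ≠ j →
        GaussClass.dimGap (GaussClass.im (S i ω)) (GaussClass.im (S j ω)) =
          ((2 * min (N - r) r : ℕ) : ℤ)) ∧
      ∀ᵐ ω' ∂Q,
        ∀ c : ℝ → EuclideanSpace ℝ (Fin M) → Fin L,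
          (∀ s, 0 < s → GaussClass.IsMAP p (fun i => S i ω) (Φ ω') s (c s)) →
          ∃ ℓ : EReal, (d₀ : EReal) < ℓ ∧
            Tendsto
              (fun s : ℝ =>
                -ENNReal.log (GaussClass.errorProb p (fun i => S i ω) (Φ ω') s (c s)) /
                  ((Real.log (1 / s) : ℝ) : EReal))
              (𝓝[>] 0) (𝓝 ℓ) := by
  have hM' : 2 * d₀ + r < M := by
    exact_mod_cast Int.floor_lt.1 (hM ▸ lt_add_one ⌊2 * d₀ + (r : ℝ)⌋)
  exact proposition2_general p P S hS hrank hpdf (fun i j hij => hindep.indepFun hij) Q Φ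
    hΦ.hasPDF d₀ hd₀ hM'
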